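/- **Theorem.** Let $X$ be a CoPolish space, i.e. a topological space that is the direct limit of an increasing sequence $K_0\subseteq K_1\subseteq\dots$ of compact metrisable subspaces, and regard $X$ as a represented space via an arbitrary admissible representation $\delta_X:\subseteq\mathbb N^{\mathbb N}\to X$ (a continuous partial surjection through which every continuous partial map $\subseteq\mathbb N^{\mathbb N}\to X$ factors continuously). Then $$\mathrm{VC}_X\;\le^{\mathrm t}_{\mathrm W}\;\widehat{\left(\mathrm{id}:\Sigma_{\Pi^1_1}\to\Sigma\right)} .$$ Here: * $\Sigma=\{\top,\bot\}$ is Sierpiński space, where $0^\omega$ is the only name of $\bot$ and every other element of $\mathbb N^{\mathbb N}$ is a name of $\top$. $\Sigma_{\Pi^1_1}$ has the same two elements, but the names of $\top$ are the codes (characteristic functions) of well-founded trees on $\mathbb N$, and the names of $\bot$ are the codes of ill-founded trees on $\mathbb N$. * $\mathcal O(X)=\mathcal C(X,\Sigma)$ is the represented space of open subsets of $X$, with the standard function space representation. $\mathcal V(X)$ is the represented space of closed subsets $A$ of $X$ in which a name of $A$ is a name of $\{U\in\mathcal O(X): U\cap A\ne\emptyset\}\in\mathcal O(\mathcal O(X))$.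 * $\mathrm{VC}_X:\subseteq\mathcal V(X)\rightrightarrows X$ (overt choice) is the multivalued function whose domain is the set of non-empty closed sets $A$ and whose values on $A$ are the points of $A$. * A partial function $F:\subseteq\mathbb N^{\mathbb N}\to\mathbb N^{\mathbb N}$ realizes a partial multivalued function $f$ between represented spaces if it maps every name of every $x\in\mathrm{dom}(f)$ to a name of some element of $f(x)$. For partial multivalued functions $f,g$ between represented spaces, $f\le^{\mathrm t}_{\mathrm W}g$ means that there are continuous partial functions $H,K:\subseteq\mathbb N^{\mathbb N}\to\mathbb N^{\mathbb N}$ such that $p\mapsto K(\langle p,G(H(p))\rangle)$ realizes $f$ whenever $G$ realizes $g$. The parallelization $\widehat g$ of $g:\subseteq U\rightrightarrows V$ is the multivalued function $\subseteq U^{\mathbb N}\rightrightarrows V^{\mathbb N}$ that applies $g$ in every coordinate. -/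

import Mathlib

namespace OvertChoice

/-! ### Baire space and partial functions on it -/

/-- Baire space, with the product topology of the discrete topology on `ℕ`. -/
abbrev Baire : Type := ℕ → ℕ

/-- The finite prefix `p 0, …, p (n - 1)`. -/
def pre (p : Baire) (n : ℕ) : List ℕ := (List.range n).map p

/-- The pairing `⟨p, q⟩ = p 0, q 0, p 1, q 1, …`. -/
def pair (p q : Baire) : Baire := fun n => if n % 2 = 0 then p (n / 2) else q (n / 2)

/-- Projection of the countable tupling `⟨p₀, p₁, …⟩ (n, k) = pₙ k`. -/
def proj (p : Baire) (n : ℕ) : Baire := fun k => p (Nat.pair n k)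

/-- A partial function is continuous if it is continuous on its domain, with the subspace topology. -/
def PContinuousOnDom {A B : Type*} [TopologicalSpace A] [TopologicalSpace B]
    (F : A →. B) : Prop :=
  Continuous F.asSubtype

/-- The partial function with a given single-valued graph. -/
noncomputable def pfunOfGraph {A B : Type*} (R : A → B → Prop) : A →. B :=
  fun a => ⟨∃ b, R a b, fun h => h.choose⟩

theorem mem_pfunOfGraph {A B : Type*} {R : A → B → Prop}
    (hR : ∀ a b b', R a b → R a b' → b = b') (a : A) (b : B) :
    b ∈ pfunOfGraph R a ↔ R a b := by
  constructor
  · rintro ⟨h, rfl⟩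
    exact h.choose_spec
  · intro h
    exact ⟨⟨b, h⟩, hR _ _ _ (Exists.choose_spec (⟨b, h⟩ : ∃ b, R a b)) h⟩

/-! ### Represented spaces, multivalued functions and realizers -/

/-- A representation of `X`: a partial surjection from Baire space onto `X`. -/
structure Representation (X : Type*) where
  rep : Baire →. X
  surj : ∀ x, ∃ p, x ∈ rep p

/-- A partial multivalued function; its domain is the set of `x` with `f x` non-empty. -/
abbrev MultiFun (X Y : Type*) := X → Set Y

/-- `F` is a realizer of `f`: for each name `p` of each `x` in the domain of `f`, `F p` is defined
and is a name of some element of `f x`. -/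
def Realizes {X Y : Type*} (δX : Representation X) (δY : Representation Y)
    (F : Baire →. Baire) (f : MultiFun X Y) : Prop :=
  ∀ p x, x ∈ δX.rep p → (f x).Nonempty → ∃ q ∈ F p, ∃ y ∈ δY.rep q, y ∈ f x

/-- A function between represented spaces is continuous if it has a continuous realizer. -/
def RContinuous {X Y : Type*} (δX : Representation X) (δY : Representation Y)
    (f : X → Y) : Prop :=
  ∃ F : Baire →. Baire, PContinuousOnDom F ∧ Realizes δX δY F (fun x => {f x})

/-! ### Function spaces -/

/-- The graph of the partial continuous function with associate `q`: the first non-zero value among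
`q ⌜n, p 0, …, p (m - 1)⌝`, `m = 0, 1, …`, is one more than the `n`-th output digit. -/
def AssociateGraph (q p r : Baire) : Prop :=
  ∀ n, ∃ m, q (Encodable.encode (n :: pre p m)) = r n + 1 ∧
    ∀ j < m, q (Encodable.encode (n :: pre p j)) = 0

/-- The universal partial continuous function: `associate q p` is the value at `p` of the partial
continuous function on Baire space that is coded by `q`. -/
noncomputable def associate (q : Baire) : Baire →. Baire :=
  pfunOfGraph (AssociateGraph q)

theorem AssociateGraph.unique (q p r r' : Baire) (h : AssociateGraph q p r)
    (h' : AssociateGraph q p r') : r = r' := by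
  funext n
  obtain ⟨m, h1, h2⟩ := h n
  obtain ⟨m', h1', h2'⟩ := h' n
  have hm : m = m' := by
    rcases lt_trichotomy m m' with hlt | heq | hgt
    · have := h2' m hlt
      omega
    · exact heq
    · have := h2 m' hgt
      omega
  subst hm
  omega

theorem mem_associate (q p r : Baire) : r ∈ associate q p ↔ AssociateGraph q p r :=
  mem_pfunOfGraph (AssociateGraph.unique q) p r

theorem length_pre (p : Baire) (n : ℕ) : (pre p n).length = n := by simp [pre]

theorem pre_eq_iff (p p' : Baire) (n : ℕ) : pre p n = pre p' n ↔ ∀ i < n, p i = p' i := by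
  simp [pre, List.map_inj_left]

theorem exists_pre_of_mem_nhds {p : Baire} {V : Set Baire} (hV : V ∈ nhds p) :
    ∃ n, ∀ p', pre p' n = pre p n → p' ∈ V := by
  rw [nhds_pi, Filter.mem_pi] at hV
  obtain ⟨I, hI, t, ht, hsub⟩ := hV
  obtain ⟨N, hN⟩ := hI.bddAbove
  refine ⟨N + 1, fun p' hp' => hsub fun i hi => ?_⟩
  rw [(pre_eq_iff _ _ _).1 hp' i (Nat.lt_succ_of_le (hN hi))]
  exact mem_of_mem_nhds (ht i)

/-- Every partial continuous function on Baire space is extended by one that has an associate. -/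
theorem exists_associate (F : Baire →. Baire) (hF : PContinuousOnDom F) :
    ∃ q, ∀ p r, r ∈ F p → r ∈ associate q p := by
  classical
  let good : List ℕ → ℕ → ℕ → Prop := fun w n k =>
    (∃ p r, r ∈ F p ∧ pre p w.length = w) ∧
      ∀ p r, r ∈ F p → pre p w.length = w → r n = k
  have huniq : ∀ {w n k k'}, good w n k → good w n k' → k = k' := by
    rintro w n k k' ⟨⟨p, r, hr, hw⟩, h⟩ ⟨_, h'⟩
    exact (h p r hr hw).symm.trans (h' p r hr hw)
  let val : ℕ → List ℕ → ℕ := fun n w => if h : ∃ k, good w n k then h.choose + 1 else 0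
  have hval : ∀ {n w k}, good w n k → val n w = k + 1 := by
    intro n w k h
    have hex : ∃ k, good w n k := ⟨k, h⟩
    simp only [val, dif_pos hex]
    rw [huniq hex.choose_spec h]
  let q : Baire := fun c => match (Encodable.decode c : Option (List ℕ)) with
    | some (n :: w) => val n w
    | _ => 0
  have hq : ∀ n w, q (Encodable.encode (n :: w)) = val n w := by
    intro n w
    simp only [q, Encodable.encodek]
  refine ⟨q, fun p r hr => (mem_associate q p r).2 fun n => ?_⟩
  have hdom : p ∈ F.Dom := Part.dom_iff_mem.2 ⟨r, hr⟩
  have hFp : F.asSubtype ⟨p, hdom⟩ = r := Part.get_eq_of_mem hr _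
  have hmem : {s : F.Dom | F.asSubtype s n = r n} ∈ nhds (⟨p, hdom⟩ : F.Dom) := by
    have hc : Continuous fun s : F.Dom => F.asSubtype s n := (continuous_apply n).comp hF
    have ho : IsOpen {s : F.Dom | F.asSubtype s n = r n} :=
      (isOpen_discrete ({r n} : Set ℕ)).preimage hc
    exact ho.mem_nhds (by simp [hFp])
  rw [nhds_subtype_eq_comap, Filter.mem_comap] at hmem
  obtain ⟨V, hV, hsub⟩ := hmem
  obtain ⟨N, hN⟩ := exists_pre_of_mem_nhds hV
  have hgoodN : good (pre p N) n (r n) := by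
    refine ⟨⟨p, r, hr, by rw [length_pre]⟩, fun p' r' hr' hp' => ?_⟩
    rw [length_pre] at hp'
    have hd' : p' ∈ F.Dom := Part.dom_iff_mem.2 ⟨r', hr'⟩
    have h1 : (⟨p', hd'⟩ : F.Dom) ∈ {s : F.Dom | F.asSubtype s n = r n} := hsub (hN p' hp')
    have h2 : F.asSubtype ⟨p', hd'⟩ = r' := Part.get_eq_of_mem hr' _
    simpa [h2] using h1
  have hpos : ∃ m, val n (pre p m) ≠ 0 := ⟨N, by rw [hval hgoodN]; omega⟩
  refine ⟨Nat.find hpos, ?_, fun j hj => ?_⟩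
  · rw [hq]
    have hne := Nat.find_spec hpos
    by_cases hex : ∃ k, good (pre p (Nat.find hpos)) n k
    · obtain ⟨k, hk⟩ := hex
      rw [hval hk, hk.2 p r hr (by rw [length_pre])]
    · exact absurd (dif_neg hex) hne
  · rw [hq]
    exact not_not.1 (Nat.find_min hpos hj)

/-- The underlying set of the space `C(X, Y)` of continuous functions. -/
abbrev RFun {X Y : Type*} (δX : Representation X) (δY : Representation Y) :=
  {f : X → Y // RContinuous δX δY f}

/-- The represented space `C(X, Y)`: `q` is a name of `f` if the partial continuous function with
associate `q` is a realizer of `f`. -/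
noncomputable def Representation.func {X Y : Type*} (δX : Representation X)
    (δY : Representation Y) : Representation (RFun δX δY) where
  rep := pfunOfGraph fun q f => Realizes δX δY (associate q) (fun x => {f.1 x})
  surj := by
    rintro ⟨f, F, hF, hFf⟩
    obtain ⟨q, hq⟩ := exists_associate F hF
    refine ⟨q, (mem_pfunOfGraph ?_ _ _).2 ?_⟩
    · intro a f g hf hg
      apply Subtype.ext
      funext x
      obtain ⟨p, hp⟩ := δX.surj x
      obtain ⟨r, hr, y, hy, hyf⟩ := hf p x hp (Set.singleton_nonempty _)
      obtain ⟨r', hr', y', hy', hyg⟩ := hg p x hp (Set.singleton_nonempty _)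
      obtain rfl := Part.mem_unique hr hr'
      obtain rfl := Part.mem_unique hy hy'
      exact (Set.mem_singleton_iff.1 hyf).symm.trans (Set.mem_singleton_iff.1 hyg)
    · intro p x hp hx
      obtain ⟨r, hr, h⟩ := hFf p x hp hx
      exact ⟨r, hq _ _ hr, h⟩

/-! ### Sierpiński space, open sets and overt sets -/

/-- Sierpiński space `Σ` with `⊤ = True` and `⊥ = False`: the only name of `⊥` is `0, 0, 0, …`. -/
def sierpinski : Representation Prop where
  rep := fun p => Part.some (∃ n, p n ≠ 0)
  surj := fun x => by
    by_cases hx : x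
    · exact ⟨fun _ => 1, by simp [hx]⟩
    · exact ⟨fun _ => 0, by simp [hx]⟩

/-- The open subsets of a represented space, as their characteristic functions into `Σ`. -/
abbrev ROpen {X : Type*} (δ : Representation X) := RFun δ sierpinski

/-- The represented space `O(X)`. -/
noncomputable def Representation.opens {X : Type*} (δ : Representation X) :
    Representation (ROpen δ) :=
  δ.func sierpinski

/-- The closed subsets of a represented space: those with open complement. -/
abbrev RClosed {X : Type*} (δ : Representation X) :=
  {A : Set X // RContinuous δ sierpinski (fun x => x ∉ A)}

theorem isOpen_coord (c k : ℕ) : IsOpen {q : Baire | q c = k} := by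
  have hc : Continuous fun q : Baire => q c := continuous_apply c
  exact (isOpen_discrete ({k} : Set ℕ)).preimage hc

/-- A set is open as soon as its names are the names in an open set of Baire space. -/
theorem rcontinuous_of_isOpen {X : Type*} (δ : Representation X) (S : X → Prop) (V : Set Baire)
    (hV : IsOpen V) (h : ∀ p x, x ∈ δ.rep p → (p ∈ V ↔ S x)) : RContinuous δ sierpinski S := by
  classical
  let F : Baire → Baire := fun p n => if ∀ p', pre p' n = pre p n → p' ∈ V then 1 else 0
  have hF : Continuous F := by
    refine continuous_pi fun n => continuous_discrete_rng.2 fun k => ?_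
    refine isOpen_iff_mem_nhds.2 fun p hp => ?_
    have hnh : {p' : Baire | ∀ i ∈ Finset.range n, p' i = p i} ∈ nhds p := by
      have ho : IsOpen {p' : Baire | ∀ i ∈ Finset.range n, p' i = p i} := by
        have : {p' : Baire | ∀ i ∈ Finset.range n, p' i = p i} =
            ⋂ i ∈ Finset.range n, {p' : Baire | p' i = p i} := by
          ext; simp
        rw [this]
        exact isOpen_biInter_finset fun i _ => isOpen_coord i (p i)
      exact ho.mem_nhds fun i _ => rfl
    filter_upwards [hnh] with p' hp'
    have he : pre p' n = pre p n := (pre_eq_iff _ _ _).2 fun i hi => hp' i (Finset.mem_range.2 hi)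
    have : F p' n = F p n := by simp only [F, he]
    simp only [Set.mem_preimage, Set.mem_singleton_iff] at hp ⊢
    rw [this, hp]
  refine ⟨fun p => Part.some (F p), ?_, fun p x hp _ => ?_⟩
  · exact hF.comp continuous_subtype_val
  · refine ⟨F p, Part.mem_some _, _, Part.mem_some _, ?_⟩
    rw [Set.mem_singleton_iff, ← h p x hp]
    refine propext ⟨?_, fun hpV => ?_⟩
    · rintro ⟨n, hn⟩
      by_contra hpV
      exact hn (if_neg fun hall => hpV (hall p rfl))
    · obtain ⟨n, hn⟩ := exists_pre_of_mem_nhds (hV.mem_nhds hpV)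
      exact ⟨n, by simp only [F, if_pos hn]; exact one_ne_zero⟩

theorem mem_opens_iff {X : Type*} (δ : Representation X) (q : Baire) (U : ROpen δ) :
    U ∈ δ.opens.rep q ↔ ∀ p x, x ∈ δ.rep p →
      ∃ r, AssociateGraph q p r ∧ ((∃ n, r n ≠ 0) ↔ U.1 x) := by
  have key : ∀ U : ROpen δ, Realizes δ sierpinski (associate q) (fun x => {U.1 x}) ↔
      ∀ p x, x ∈ δ.rep p → ∃ r, AssociateGraph q p r ∧ ((∃ n, r n ≠ 0) ↔ U.1 x) := by
    intro U
    constructor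
    · intro h p x hp
      obtain ⟨r, hr, y, hy, hyU⟩ := h p x hp (Set.singleton_nonempty _)
      refine ⟨r, (mem_associate _ _ _).1 hr, ?_⟩
      have h1 : y = ∃ n, r n ≠ 0 := Part.mem_some_iff.1 hy
      rw [← h1, Set.mem_singleton_iff.1 hyU]
    · intro h p x hp _
      obtain ⟨r, hr, hrU⟩ := h p x hp
      exact ⟨r, (mem_associate _ _ _).2 hr, _, Part.mem_some _, propext hrU⟩
  refine (mem_pfunOfGraph ?_ _ _).trans (key U)
  intro q' f g hf hg
  apply Subtype.ext
  funext x
  obtain ⟨p, hp⟩ := δ.surj x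
  obtain ⟨r, hr, y, hy, hyf⟩ := hf p x hp (Set.singleton_nonempty _)
  obtain ⟨r', hr', y', hy', hyg⟩ := hg p x hp (Set.singleton_nonempty _)
  obtain rfl := Part.mem_unique hr hr'
  obtain rfl := Part.mem_unique hy hy'
  exact (Set.mem_singleton_iff.1 hyf).symm.trans (Set.mem_singleton_iff.1 hyg)

/-- For any set `A`, the open sets that meet `A` form an open subset of `O(X)`. -/
theorem rcontinuous_meets {X : Type*} (δ : Representation X) (A : Set X) :
    RContinuous δ.opens sierpinski (fun U : ROpen δ => ∃ x ∈ A, U.1 x) := by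
  let V : Set Baire := ⋃ (p : Baire) (_ : ∃ x ∈ A, x ∈ δ.rep p) (n : ℕ) (m : ℕ) (k : ℕ),
    {q : Baire | q (Encodable.encode (n :: pre p m)) = k + 2} ∩
      ⋂ j ∈ Finset.range m, {q : Baire | q (Encodable.encode (n :: pre p j)) = 0}
  have hpt : ∀ c k : ℕ, IsOpen {q : Baire | q c = k} := isOpen_coord
  have hV : IsOpen V := by
    refine isOpen_iUnion fun p => isOpen_iUnion fun _ => isOpen_iUnion fun n =>
      isOpen_iUnion fun m => isOpen_iUnion fun k => (hpt _ _).inter ?_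
    exact isOpen_biInter_finset fun j _ => hpt _ _
  refine rcontinuous_of_isOpen δ.opens _ V hV fun q U hq => ?_
  rw [mem_opens_iff] at hq
  simp only [V, Set.mem_iUnion, Set.mem_inter_iff, Set.mem_iInter, Set.mem_ofPred_eq,
    Finset.mem_range]
  constructor
  · rintro ⟨p, ⟨x, hxA, hp⟩, n, m, k, h1, h2⟩
    obtain ⟨r, hr, hrU⟩ := hq p x hp
    refine ⟨x, hxA, hrU.1 ⟨n, ?_⟩⟩
    obtain ⟨m', h1', h2'⟩ := hr n
    have hm : m = m' := by
      rcases lt_trichotomy m m' with hlt | heq | hgt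
      · have := h2' m hlt
        omega
      · exact heq
      · have := h2 m' hgt
        omega
    subst hm
    omega
  · rintro ⟨x, hxA, hxU⟩
    obtain ⟨p, hp⟩ := δ.surj x
    obtain ⟨r, hr, hrU⟩ := hq p x hp
    obtain ⟨n, hn⟩ := hrU.2 hxU
    obtain ⟨m, h1, h2⟩ := hr n
    exact ⟨p, ⟨x, hxA, hp⟩, n, m, r n - 1, by omega, h2⟩

/-- The element `{U ∈ O(X) | U ∩ A ≠ ∅}` of `O(O(X))`. -/
def meets {X : Type*} (δ : Representation X) (A : Set X) : ROpen δ.opens :=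
  ⟨fun U => ∃ x ∈ A, U.1 x, rcontinuous_meets δ A⟩

theorem meets_injective {X : Type*} (δ : Representation X) (A B : RClosed δ)
    (h : meets δ A.1 = meets δ B.1) : A = B := by
  have h' : ∀ U : ROpen δ, (∃ x ∈ A.1, U.1 x) ↔ ∃ x ∈ B.1, U.1 x := fun U =>
    iff_of_eq (congrFun (congrArg Subtype.val h) U)
  apply Subtype.ext
  apply Set.Subset.antisymm
  · intro x hx
    by_contra hxB
    obtain ⟨y, hy, hyB⟩ := (h' ⟨_, B.2⟩).1 ⟨x, hx, hxB⟩
    exact hyB hy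
  · intro x hx
    by_contra hxA
    obtain ⟨y, hy, hyA⟩ := (h' ⟨_, A.2⟩).2 ⟨x, hx, hxA⟩
    exact hyA hy

/-- The represented space `V(X)` of closed overt sets: the names of a closed set `A` are the names
of `{U ∈ O(X) | U ∩ A ≠ ∅}` in `O(O(X))`. -/
noncomputable def Representation.overt {X : Type*} (δ : Representation X) :
    Representation (RClosed δ) where
  rep := pfunOfGraph fun q A => meets δ A.1 ∈ δ.opens.opens.rep q
  surj := fun A => by
    obtain ⟨q, hq⟩ := δ.opens.opens.surj (meets δ A.1)
    refine ⟨q, (mem_pfunOfGraph ?_ _ _).2 hq⟩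
    exact fun _ _ _ h h' => meets_injective δ _ _ (Part.mem_unique h h')

/-- Overt choice: its domain consists of the non-empty closed sets, and any point of `A` is a
solution for `A`. -/
def VC {X : Type*} (δ : Representation X) : MultiFun (RClosed δ) X := fun A => A.1

/-! ### Topological Weihrauch reducibility and parallelization -/

/-- Topological Weihrauch reducibility: there are partial continuous `H`, `K` such that
`p ↦ K ⟨p, G (H p)⟩` realizes `f` for each realizer `G` of `g`. -/
def WeihrauchLE {X Y U V : Type*} (δX : Representation X) (δY : Representation Y)
    (f : MultiFun X Y) (δU : Representation U) (δV : Representation V) (g : MultiFun U V) :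
    Prop :=
  ∃ H K : Baire →. Baire, PContinuousOnDom H ∧ PContinuousOnDom K ∧
    ∀ G : Baire →. Baire, Realizes δU δV G g →
      Realizes δX δY (fun p => (H p).bind fun h => (G h).bind fun q => K (pair p q)) f

/-- The represented space of sequences in `X`. -/
noncomputable def Representation.seq {X : Type*} (δ : Representation X) :
    Representation (ℕ → X) where
  rep := pfunOfGraph fun p x => ∀ n, x n ∈ δ.rep (proj p n)
  surj := fun x => by
    choose p hp using fun n => δ.surj (x n)
    refine ⟨fun c => p c.unpair.1 c.unpair.2, (mem_pfunOfGraph ?_ _ _).2 fun n => ?_⟩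
    · exact fun _ _ _ h h' => funext fun n => Part.mem_unique (h n) (h' n)
    · have : proj (fun c => p c.unpair.1 c.unpair.2) n = p n := by
        funext k
        simp [proj]
      rw [this]
      exact hp n

/-- The parallelization of `f`. -/
def parallelization {X Y : Type*} (f : MultiFun X Y) : MultiFun (ℕ → X) (ℕ → Y) :=
  fun x => {y | ∀ n, y n ∈ f (x n)}

/-! ### The space of truth values of well-foundedness -/

/-- `p` is the characteristic function of a tree, a set of finite sequences closed under
prefixes. -/
def CodesTree (p : Baire) : Prop :=
  (∀ n, p n = 0 ∨ p n = 1) ∧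
    ∀ v w : List ℕ, v <+: w → p (Encodable.encode w) = 1 → p (Encodable.encode v) = 1

/-- The tree coded by `p` has no infinite path. -/
def CodesWellFounded (p : Baire) : Prop :=
  ¬ ∃ f : Baire, ∀ n, p (Encodable.encode (pre f n)) = 1

/-- The represented space with the two elements `⊤ = True` and `⊥ = False` in which the names of
`⊤` are the codes of well-founded trees and the names of `⊥` the codes of ill-founded trees. -/
def sigmaPi11 : Representation Prop where
  rep := fun p => ⟨CodesTree p, fun _ => CodesWellFounded p⟩
  surj := fun x => by
    by_cases hx : x
    · refine ⟨fun _ => 0, ⟨fun _ => Or.inl rfl, fun _ _ _ h => h⟩, ?_⟩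
      simp [CodesWellFounded, hx]
    · refine ⟨fun _ => 1, ⟨fun _ => Or.inr rfl, fun _ _ _ h => h⟩, ?_⟩
      simp [CodesWellFounded, hx]

/-- The identity as a (single-valued) map, here from `sigmaPi11` to `sierpinski`. -/
def idSigma : MultiFun Prop Prop := fun x => {x}

/-! ### CoPolish spaces and admissible representations -/

/-- A CoPolish space: the direct limit of an increasing sequence of compact metrizable subspaces. -/
def IsCoPolish (X : Type*) [TopologicalSpace X] : Prop :=
  ∃ K : ℕ → Set X, Monotone K ∧ (∀ n, IsCompact (K n)) ∧
    (∀ n, TopologicalSpace.MetrizableSpace (K n)) ∧ (⋃ n, K n) = Set.univ ∧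
    ∀ U : Set X, IsOpen U ↔ ∀ n, IsOpen ((↑) ⁻¹' U : Set (K n))

/-- A representation of a topological space is admissible if it is continuous and each partial
continuous function from Baire space to `X` factors continuously through it. -/
def IsAdmissible {X : Type*} [TopologicalSpace X] (δ : Representation X) : Prop :=
  PContinuousOnDom δ.rep ∧
    ∀ φ : Baire →. X, PContinuousOnDom φ →
      ∃ F : Baire →. Baire, PContinuousOnDom F ∧ ∀ p x, x ∈ φ p → ∃ q ∈ F p, x ∈ δ.rep q

end OvertChoice

namespace OvertChoice

open Set Filter Topology

/-! The problem is pulled back to Baire space along a continuous surjection `φ`. If one can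
recognise the words `c` for which `φ '' cyl c` meets `A`, a point of the closed set `φ ⁻¹' A` is
found digit by digit, and a continuous lift of `φ` through `δ`, given by admissibility, turns it
into a name of a point of `A`. So it suffices that disjointness of `φ '' cyl c` from `A` is the
non-emptiness of the section, over the name `q` of `A`, of a closed set: the section is then the set
of paths of a tree, and `id` semi-decides its well-foundedness.

Disjointness is witnessed by an open set that contains `φ '' cyl c` and misses `A`; the complement
of `A` is the largest candidate. An open set is presented by an enumeration `s` of cylinders whose
union is saturated, and `q` is then evaluated on a name of `φ '' wordUnion s`. Two points need the
CoPolish structure. Such a name must depend continuously on `s`: this follows from the lifting of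
convergent sequences (`exists_certifies_iff`). Saturation must become a closed condition once a
witness is added: this follows from compactness of the sets `Z n`, which yields bounds on finite
subcovers (`IsSaturated.exists_witness`, `isClosed_saturationWitness`).
`exists_disjointnessWitness_iff` combines them. -/

/-- The basic clopen set of Baire space given by the code of a non-empty word (and the empty set for
any other number). -/
def cyl (c : ℕ) : Set Baire := {p | ∃ m, Encodable.encode (pre p (m + 1)) = c}

theorem mem_cyl_pre (p : Baire) (m : ℕ) : p ∈ cyl (Encodable.encode (pre p (m + 1))) := ⟨m, rfl⟩

theorem mem_cyl_encode_pre {p p' : Baire} {m : ℕ} :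
    p' ∈ cyl (Encodable.encode (pre p (m + 1))) ↔ pre p' (m + 1) = pre p (m + 1) := by
  refine ⟨?_, fun h => ⟨m, by rw [h]⟩⟩
  rintro ⟨k, hk⟩
  have h := Encodable.encode_injective hk
  have hl := congrArg List.length h
  rw [length_pre, length_pre] at hl
  rwa [hl] at h

theorem isOpen_pre_eq (p : Baire) (n : ℕ) : IsOpen {p' : Baire | pre p' n = pre p n} := by
  have : {p' : Baire | pre p' n = pre p n} = ⋂ i ∈ Finset.range n, {p' : Baire | p' i = p i} := by
    ext p'
    simp [pre_eq_iff]
  rw [this]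
  exact isOpen_biInter_finset fun i _ => isOpen_coord i (p i)

theorem pre_eventually_eq (p : Baire) (n : ℕ) : ∀ᶠ p' in 𝓝 p, pre p' n = pre p n :=
  (isOpen_pre_eq p n).mem_nhds rfl

theorem isOpen_cyl (c : ℕ) : IsOpen (cyl c) := by
  refine isOpen_iff_mem_nhds.2 ?_
  rintro p ⟨m, rfl⟩
  filter_upwards [pre_eventually_eq p (m + 1)] with p' hp'
  exact mem_cyl_encode_pre.2 hp'

/-! ### Lifting convergent sequences of a CoPolish space to Baire space -/

/-- A continuous map `φ` from Baire space that lifts convergent sequences, up to passing to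
subsequences, with limits in a sequence of compact sets. -/
structure IsCompactlyLifting {X : Type*} [TopologicalSpace X] (φ : Baire → X) (Z : ℕ → Set Baire) :
    Prop where
  continuous : Continuous φ
  isCompact : ∀ n, IsCompact (Z n)
  isClosed_image : ∀ c, IsClosed (φ '' cyl c)
  lift : ∀ (u : ℕ → X) (x : X), Tendsto u atTop (𝓝 x) → ∃ n, ∃ y ∈ Z n, φ y = x ∧
    ∃ ψ : ℕ → ℕ, StrictMono ψ ∧ ∃ v : ℕ → Baire, (∀ k, φ (v k) = u (ψ k)) ∧
      Tendsto v atTop (𝓝 y)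

section DirectLimit

variable {X : Type*} [TopologicalSpace X] {K : ℕ → Set X}

theorem isClosed_directLimit (hopen : ∀ U : Set X, IsOpen U ↔ ∀ n, IsOpen ((↑) ⁻¹' U : Set (K n)))
    {C : Set X} (h : ∀ n, IsClosed ((↑) ⁻¹' C : Set (K n))) : IsClosed C := by
  rw [← isOpen_compl_iff, hopen]
  intro n
  rw [preimage_compl, isOpen_compl_iff]
  exact h n

/-- Every trace of `C` on some `K m` is pulled back from the larger Hausdorff stage `K (max n m)`,
where `C` is compact and hence closed. Hausdorffness of `X` itself is not needed. -/
theorem isClosed_of_isCompact_directLimit (hK : Monotone K) [∀ n, T2Space (K n)]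
    (hopen : ∀ U : Set X, IsOpen U ↔ ∀ n, IsOpen ((↑) ⁻¹' U : Set (K n)))
    {C : Set X} (hC : IsCompact C) {n : ℕ} (hCn : C ⊆ K n) : IsClosed C := by
  refine isClosed_directLimit hopen fun m => ?_
  have hle : K m ⊆ K (max n m) := hK (le_max_right n m)
  have hsub : C ⊆ K (max n m) := hCn.trans (hK (le_max_left n m))
  have hcpt : IsCompact ((↑) ⁻¹' C : Set (K (max n m))) := by
    rw [Subtype.isCompact_iff, Subtype.image_preimage_coe, inter_eq_self_of_subset_right hsub]
    exact hC
  exact hcpt.isClosed.preimage (continuous_inclusion hle)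

/-- Otherwise the terms different from `x` have finite trace on each `K n`, so they form a closed
set that omits `x`. Then the sequence is eventually equal to `x`, which lies in some `K n`. -/
theorem exists_frequently_mem_of_tendsto [∀ n, T1Space (K n)] (huniv : ⋃ n, K n = univ)
    (hopen : ∀ U : Set X, IsOpen U ↔ ∀ n, IsOpen ((↑) ⁻¹' U : Set (K n)))
    {u : ℕ → X} {x : X} (hu : Tendsto u atTop (𝓝 x)) : ∃ n, ∃ᶠ k in atTop, u k ∈ K n := by
  by_contra! hcon
  have hF : IsClosed {z | ∃ k, u k = z ∧ z ≠ x} := by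
    refine isClosed_directLimit hopen fun n => ?_
    obtain ⟨N, hN⟩ := eventually_atTop.1 (hcon n)
    refine Set.Finite.isClosed ?_
    have hfin : (((↑) : K n → X) ⁻¹' (u '' Iio N)).Finite :=
      ((finite_Iio N).image u).preimage Subtype.val_injective.injOn
    refine hfin.subset ?_
    rintro ⟨z, hz⟩ ⟨k, hk, -⟩
    refine ⟨k, ?_, hk⟩
    by_contra hkN
    have hk' : u k = z := hk
    exact hN k (not_lt.1 hkN) (hk' ▸ hz)
  have hev : ∀ᶠ k in atTop, u k ∈ {z | ∃ k, u k = z ∧ z ≠ x}ᶜ :=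
    hu (hF.isOpen_compl.mem_nhds (by simp))
  obtain ⟨n, hn⟩ := mem_iUnion.1 (huniv.symm ▸ mem_univ x : x ∈ ⋃ n, K n)
  obtain ⟨k, hk1, hk2⟩ := (hev.and (hcon n)).exists
  have : u k = x := by
    by_contra hne
    exact hk1 ⟨k, rfl, hne⟩
  exact hk2 (this ▸ hn)

end DirectLimit

/-- The sequences that extend the word `w` by binary digits. -/
def binaryExtensions (w : List ℕ) : Set Baire :=
  univ.pi fun i => if h : i < w.length then {w[i]} else {0, 1}

theorem isCompact_binaryExtensions (w : List ℕ) : IsCompact (binaryExtensions w) := by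
  refine isCompact_univ_pi fun i => ?_
  split_ifs
  · exact isCompact_singleton
  · exact (toFinite _).isCompact

theorem mem_binaryExtensions_pre {p p' : Baire} {n : ℕ} :
    p' ∈ binaryExtensions (pre p n) ↔
      (∀ i < n, p' i = p i) ∧ ∀ i, n ≤ i → p' i = 0 ∨ p' i = 1 := by
  simp only [binaryExtensions, Set.mem_pi, mem_univ, true_implies, length_pre]
  constructor
  · intro h
    refine ⟨fun i hi => ?_, fun i hi => ?_⟩
    · have := h i
      rw [dif_pos hi] at this
      simpa [pre] using this
    · have := h i
      rw [dif_neg (not_lt.2 hi)] at this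
      simpa using this
  · rintro ⟨h1, h2⟩ i
    split_ifs with hi
    · simpa [pre] using h1 i hi
    · simpa using h2 i (not_lt.1 hi)

/-- Glues a sequence of maps on Cantor space to a map on Baire space; the first digit selects the
map. -/
def glue {X : Type*} (f : ℕ → (ℕ → Bool) → X) (p : Baire) : X :=
  f (p 0) fun i => decide (p (i + 1) ≠ 0)

theorem continuous_glue {X : Type*} [TopologicalSpace X] {f : ℕ → (ℕ → Bool) → X}
    (hf : ∀ n, Continuous (f n)) : Continuous (glue f) := by
  have hbits : Continuous fun (p : Baire) (i : ℕ) => decide (p (i + 1) ≠ 0) :=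
    continuous_pi fun i =>
      (continuous_of_discreteTopology (f := fun k : ℕ => decide (k ≠ 0))).comp
        (continuous_apply (i + 1))
  refine continuous_iff_continuousAt.2 fun p => ?_
  refine ((hf (p 0)).comp hbits).continuousAt.congr ?_
  filter_upwards [(isOpen_coord 0 (p 0)).mem_nhds rfl] with p' hp'
  have : p' 0 = p 0 := hp'
  simp [glue, this]

/-- After the first digit, `glue` only sees whether a digit is zero, so digits beyond the prefix can
be truncated at 1. This exhibits the image of a cylinder as the image of a compact set. -/
theorem glue_image_cyl {X : Type*} (f : ℕ → (ℕ → Bool) → X) (p : Baire) (m : ℕ) :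
    glue f '' cyl (Encodable.encode (pre p (m + 1))) =
      glue f '' binaryExtensions (pre p (m + 1)) := by
  apply Subset.antisymm
  · rintro _ ⟨p', hp', rfl⟩
    rw [mem_cyl_encode_pre, pre_eq_iff] at hp'
    refine ⟨fun i => if i < m + 1 then p' i else min (p' i) 1, ?_, ?_⟩
    · rw [mem_binaryExtensions_pre]
      refine ⟨fun i hi => by rw [if_pos hi, hp' i hi], fun i hi => ?_⟩
      rw [if_neg (not_lt.2 hi)]
      omega
    -- The first digit selects the map and must survive truncation; this is why `cyl` only admits
    -- non-empty words.
    · have h0 : (if 0 < m + 1 then p' 0 else min (p' 0) 1) = p' 0 := if_pos (Nat.succ_pos m)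
      simp only [glue, h0]
      congr 1
      funext i
      split_ifs
      · rfl
      · congr 1
        apply propext
        omega
  · refine image_mono fun p' hp' => ?_
    rw [mem_cyl_encode_pre, pre_eq_iff]
    exact (mem_binaryExtensions_pre.1 hp').1

/-- Each non-empty compact metrizable stage is a continuous image of Cantor space, and `φ` glues
these maps. A convergent sequence has a subsequence in one stage, which lifts to a single copy of
Cantor space; compactness of that copy gives a convergent subsequence of lifts. -/
theorem exists_isCompactlyLifting {X : Type*} [TopologicalSpace X] [Nonempty X]
    (hX : IsCoPolish X) : ∃ (φ : Baire → X) (Z : ℕ → Set Baire), IsCompactlyLifting φ Z := by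
  obtain ⟨K, hmono, hcpt, hmetr, huniv, hopen⟩ := hX
  obtain ⟨x₀⟩ := ‹Nonempty X›
  -- Stages before `N` may be empty, so the gluing starts at `N`.
  obtain ⟨N, hN⟩ := mem_iUnion.1 (huniv.symm ▸ mem_univ x₀ : x₀ ∈ ⋃ n, K n)
  have hf : ∀ n, ∃ f : (ℕ → Bool) → X, Continuous f ∧ range f = K (N + n) := by
    intro n
    have : Nonempty (K (N + n)) := ⟨⟨x₀, hmono (Nat.le_add_right N n) hN⟩⟩
    have : CompactSpace (K (N + n)) := isCompact_iff_compactSpace.1 (hcpt _)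
    let : MetricSpace (K (N + n)) := TopologicalSpace.metrizableSpaceMetric _
    obtain ⟨f, hfc, hfs⟩ := exists_nat_bool_continuous_surjective_of_compact (K (N + n))
    refine ⟨fun b => f b, continuous_subtype_val.comp hfc, ?_⟩
    rw [show (fun b => (f b : X)) = Subtype.val ∘ f from rfl, range_comp, hfs.range_eq, image_univ,
      Subtype.range_coe]
  choose f hfc hfr using hf
  have hmem : ∀ p, glue f p ∈ K (N + p 0) := fun p => hfr (p 0) ▸ mem_range_self _
  have hglue := continuous_glue hfc
  refine ⟨glue f, fun n => binaryExtensions (pre (fun _ => n) 1), hglue,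
    fun n => isCompact_binaryExtensions _, fun c => ?_, fun u x hu => ?_⟩
  · rcases (cyl c).eq_empty_or_nonempty with h | ⟨p, m, rfl⟩
    · rw [h, image_empty]
      exact isClosed_empty
    · rw [glue_image_cyl]
      refine isClosed_of_isCompact_directLimit hmono hopen
        ((isCompact_binaryExtensions _).image hglue) (n := N + p 0) ?_
      rintro _ ⟨p', hp', rfl⟩
      rw [← (mem_binaryExtensions_pre.1 hp').1 0 (Nat.succ_pos m)]
      exact hmem p'
  · obtain ⟨n, hn⟩ := exists_frequently_mem_of_tendsto huniv hopen hu
    have hn' : ∃ᶠ k in atTop, u k ∈ K (N + n) :=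
      hn.mono fun k hk => hmono (Nat.le_add_left n N) hk
    obtain ⟨ψ, hψ, hψK⟩ := extraction_of_frequently_atTop hn'
    have hv : ∀ k, ∃ v ∈ binaryExtensions (pre (fun _ => n) 1), glue f v = u (ψ k) := by
      intro k
      obtain ⟨b, hb⟩ := (hfr n).symm ▸ hψK k
      refine ⟨fun i => Nat.casesOn i n fun j => (b j).toNat, ?_, ?_⟩
      · rw [mem_binaryExtensions_pre]
        refine ⟨fun i hi => ?_, fun i hi => ?_⟩
        · obtain rfl : i = 0 := by omega
          rfl
        · obtain ⟨j, rfl⟩ := Nat.exists_eq_add_of_le' hi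
          cases h : b j <;> simp [h]
      · rw [← hb]
        simp only [glue]
        congr 1
        funext i
        have hbool : ∀ a : Bool, decide (a.toNat ≠ 0) = a := by decide
        convert hbool (b i)
    choose v hvZ hvu using hv
    obtain ⟨y, hy, θ, hθ, hlim⟩ := (isCompact_binaryExtensions _).tendsto_subseq hvZ
    refine ⟨n, y, hy, ?_, ψ ∘ θ, hψ.comp hθ, v ∘ θ, fun k => hvu (θ k), hlim⟩
    have hclosed : IsClosed (K (N + n)) :=
      isClosed_of_isCompact_directLimit hmono hopen (hcpt _) Subset.rfl
    have hxK : x ∈ K (N + n) :=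
      hclosed.mem_of_tendsto (hu.comp hψ.tendsto_atTop) (Eventually.of_forall hψK)
    have h0 : ∀ v ∈ binaryExtensions (pre (fun _ => n) 1), glue f v ∈ K (N + n) := by
      intro v hv
      have := (mem_binaryExtensions_pre.1 hv).1 0 Nat.one_pos
      exact this ▸ hmem v
    -- Limits are compared inside `K (N + n)`, which is Hausdorff, to conclude `glue f y = x`.
    have h1 : Tendsto (fun k => (⟨u (ψ (θ k)), hψK _⟩ : K (N + n))) atTop
        (𝓝 ⟨x, hxK⟩) :=
      tendsto_subtype_rng.2 (hu.comp (hψ.comp hθ).tendsto_atTop)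
    have h2 : Tendsto (fun k => (⟨u (ψ (θ k)), hψK _⟩ : K (N + n))) atTop
        (𝓝 ⟨glue f y, h0 y hy⟩) := by
      refine tendsto_subtype_rng.2 (((hglue.tendsto y).comp hlim).congr fun k => ?_)
      exact hvu (θ k)
    exact congrArg Subtype.val (tendsto_nhds_unique h2 h1)

/-! ### Sequences and partial continuous functions -/

theorem tendsto_of_pre_eq {v : ℕ → Baire} {p : Baire} (h : ∀ n, pre (v n) n = pre p n) :
    Tendsto v atTop (𝓝 p) := by
  refine tendsto_pi_nhds.2 fun i => tendsto_const_nhds.congr' ?_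
  filter_upwards [eventually_gt_atTop i] with n hn
  exact ((pre_eq_iff _ _ _).1 (h n) i hn).symm

theorem PContinuousOnDom.tendsto {A B : Type*} [TopologicalSpace A] [TopologicalSpace B]
    {F : A →. B} (hF : PContinuousOnDom F) {a : ℕ → A} {b : ℕ → B} {a' : A} {b' : B}
    (ha : Tendsto a atTop (𝓝 a')) (hb : ∀ n, b n ∈ F (a n)) (hb' : b' ∈ F a') :
    Tendsto b atTop (𝓝 b') := by
  have h1 : Tendsto (fun n => (⟨a n, Part.dom_iff_mem.2 ⟨_, hb n⟩⟩ : F.Dom)) atTop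
      (𝓝 ⟨a', Part.dom_iff_mem.2 ⟨_, hb'⟩⟩) := tendsto_subtype_rng.2 ha
  have h2 := (Continuous.tendsto hF _).comp h1
  have h3 : F.asSubtype ⟨a', Part.dom_iff_mem.2 ⟨_, hb'⟩⟩ = b' := Part.get_eq_of_mem hb' _
  rw [h3] at h2
  exact h2.congr fun n => Part.get_eq_of_mem (hb n) _

theorem PContinuousOnDom.of_total {A B : Type*} [TopologicalSpace A] [TopologicalSpace B]
    {f : A → B} (hf : Continuous f) : PContinuousOnDom (fun a => Part.some (f a)) :=
  hf.comp continuous_subtype_val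

theorem PContinuousOnDom.exists_total {A B C : Type*} [TopologicalSpace A] [TopologicalSpace B]
    [TopologicalSpace C] {F : A →. B} (hF : PContinuousOnDom F) {g : C → A} (hg : Continuous g)
    (hdom : ∀ c, (F (g c)).Dom) : ∃ f : C → B, Continuous f ∧ ∀ c, f c ∈ F (g c) :=
  ⟨fun c => F.asSubtype ⟨g c, hdom c⟩, Continuous.comp hF (hg.subtype_mk hdom),
    fun c => Part.get_mem (hdom c)⟩

/-! ### Names of open sets from saturated enumerations of cylinders -/

/-- The open set enumerated by a sequence of codes of words. -/
def wordUnion (s : Baire) : Set Baire := ⋃ i, cyl (s i)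

/-- Index 0 is reserved for `c`, so that containing `cyl c` can be imposed by the closed condition
`s 0 = c`. -/
theorem exists_wordUnion_eq {O : Set Baire} (hO : IsOpen O) {c : ℕ} (hc : cyl c ⊆ O) :
    ∃ s : Baire, s 0 = c ∧ wordUnion s = O := by
  classical
  -- Index `i + 1` tests the code `i`; `c` is a harmless default since its cylinder lies in `O`.
  refine ⟨fun i => if i = 0 then c else if cyl (i - 1) ⊆ O then i - 1 else c, if_pos rfl,
    Subset.antisymm (iUnion_subset fun i => ?_) fun p hp => ?_⟩
  · dsimp only
    split_ifs with h1 h2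
    · exact hc
    · exact h2
    · exact hc
  · obtain ⟨n, hn⟩ := exists_pre_of_mem_nhds (hO.mem_nhds hp)
    refine mem_iUnion.2 ⟨Encodable.encode (pre p (n + 1)) + 1, ?_⟩
    have hsub : cyl (Encodable.encode (pre p (n + 1))) ⊆ O := fun p' hp' => by
      rw [mem_cyl_encode_pre, pre_eq_iff] at hp'
      exact hn p' ((pre_eq_iff _ _ _).2 fun i hi => hp' i (hi.trans n.lt_succ_self))
    simp only [Nat.add_one_ne_zero, if_false, Nat.add_sub_cancel, if_pos hsub]
    exact mem_cyl_pre p n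

variable {X : Type*}

/-- The set enumerated by `s` contains, with each point, all points of the sets `Z n` that have the
same image under `φ`. -/
def IsSaturated (φ : Baire → X) (Z : ℕ → Set Baire) (s : Baire) : Prop :=
  ∀ y ∈ wordUnion s, ∀ n, ∀ y' ∈ Z n, φ y' = φ y → y' ∈ wordUnion s

/-- `t` gives bounds on the finite subcovers that witness the saturation of `s`. -/
def SaturationWitness (φ : Baire → X) (Z : ℕ → Set Baire) (s t : Baire) : Prop :=
  ∀ i n, ∀ y ∈ Z n, φ y ∈ φ '' cyl (s i) → ∃ j < t (Nat.pair i n), y ∈ cyl (s j)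

theorem SaturationWitness.isSaturated {φ : Baire → X} {Z : ℕ → Set Baire} {s t : Baire}
    (h : SaturationWitness φ Z s t) : IsSaturated φ Z s := by
  intro y hy n y' hy' he
  obtain ⟨i, hi⟩ := mem_iUnion.1 hy
  obtain ⟨j, -, hj⟩ := h i n y' hy' ⟨y, hi, he.symm⟩
  exact mem_iUnion.2 ⟨j, hj⟩

/-- The words `a` and `b` of length `n` suffice to see that the point named by an extension of `b`
is in the set coded by an extension of `a`. -/
def Certifies (δ : Representation X) (φ : Baire → X) (Z : ℕ → Set Baire) (n : ℕ) (a b : List ℕ) :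
    Prop :=
  ∀ s p x, IsSaturated φ Z s → pre s n = a → pre p n = b → x ∈ δ.rep p → x ∈ φ '' wordUnion s

open Classical in
/-- The output of the associate `openName s` on the query word `n :: b`. -/
noncomputable def openNameAux (δ : Representation X) (φ : Baire → X) (Z : ℕ → Set Baire)
    (s : Baire) : List ℕ → ℕ
  | [] => 0
  | n :: b => if b.length < n then 0 else if Certifies δ φ Z n (pre s n) (b.take n) then 2 else 1

/-- A name of the open set `φ '' wordUnion s`. -/
noncomputable def openName (δ : Representation X) (φ : Baire → X) (Z : ℕ → Set Baire) (s : Baire) :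
    Baire :=
  fun c => ((Encodable.decode c : Option (List ℕ)).map (openNameAux δ φ Z s)).getD 0

theorem continuous_openName (δ : Representation X) (φ : Baire → X) (Z : ℕ → Set Baire) :
    Continuous (openName δ φ Z) := by
  refine continuous_pi fun c => continuous_discrete_rng.2 fun k =>
    isOpen_iff_mem_nhds.2 fun s hs => ?_
  have hs' : openName δ φ Z s c = k := hs
  rcases h : (Encodable.decode c : Option (List ℕ)) with _ | _ | ⟨n, b⟩
  · refine univ_mem' fun s' => ?_
    simpa only [mem_preimage, mem_singleton_iff, openName, h, Option.map_none] using hs'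
  · refine univ_mem' fun s' => ?_
    simpa only [mem_preimage, mem_singleton_iff, openName, h, Option.map_some, openNameAux] using hs'
  · filter_upwards [pre_eventually_eq s n] with s' hs2
    have he : openNameAux δ φ Z s' (n :: b) = openNameAux δ φ Z s (n :: b) := by
      rw [openNameAux, openNameAux, hs2]
    simpa only [mem_preimage, mem_singleton_iff, openName, h, Option.map_some, he] using hs'

/-- Preimages of open sets under a map with a continuous lift to names are open. -/
theorem isOpen_preimage_of_rcontinuous {φ : Baire → X} {δ : Representation X} {g : Baire → Baire}
    (hg : Continuous g) (hgφ : ∀ p, φ p ∈ δ.rep (g p)) {S : X → Prop}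
    (hS : RContinuous δ sierpinski S) : IsOpen {p | S (φ p)} := by
  obtain ⟨F, hF, hFS⟩ := hS
  have hreal : ∀ p, ∃ r ∈ F (g p), (∃ n, r n ≠ 0) ↔ S (φ p) := by
    intro p
    obtain ⟨r, hr, y, hy, hyS⟩ := hFS _ _ (hgφ p) (singleton_nonempty _)
    have h1 : y = ∃ n, r n ≠ 0 := Part.mem_some_iff.1 hy
    exact ⟨r, hr, iff_of_eq (h1.symm.trans hyS)⟩
  obtain ⟨f, hf, hfF⟩ := hF.exists_total hg fun p =>
    Part.dom_iff_mem.2 ((hreal p).imp fun _ h => h.1)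
  have : {p | S (φ p)} = ⋃ n, f ⁻¹' {r | r n = 0}ᶜ := by
    ext p
    obtain ⟨r, hr, hrS⟩ := hreal p
    obtain rfl := Part.mem_unique hr (hfF p)
    simp [← hrS]
  rw [this]
  refine isOpen_iUnion fun n => IsOpen.preimage hf ?_
  have hc : Continuous fun r : Baire => r n := continuous_apply n
  exact ((isClosed_discrete ({0} : Set ℕ)).preimage hc).isOpen_compl

section Topology

variable [TopologicalSpace X] {φ : Baire → X} {Z : ℕ → Set Baire}

/-- The part of `Z n` lying over the closed set `φ '' cyl (s i)` is compact, and saturation says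
that the enumerated cylinders cover it, so finitely many suffice. -/
theorem IsSaturated.exists_witness (hφ : IsCompactlyLifting φ Z) {s : Baire}
    (hs : IsSaturated φ Z s) : ∃ t, SaturationWitness φ Z s t := by
  have key : ∀ i n, ∃ k, ∀ y ∈ Z n, φ y ∈ φ '' cyl (s i) → ∃ j < k, y ∈ cyl (s j) := by
    intro i n
    have hcpt : IsCompact (Z n ∩ φ ⁻¹' (φ '' cyl (s i))) :=
      (hφ.isCompact n).inter_right ((hφ.isClosed_image (s i)).preimage hφ.continuous)
    obtain ⟨I, hI⟩ := hcpt.elim_finite_subcover (fun j => cyl (s j)) (fun j => isOpen_cyl _) (by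
      rintro y ⟨hy, y', hy', he⟩
      exact hs y' (mem_iUnion.2 ⟨i, hy'⟩) n y hy he.symm)
    obtain ⟨k, hk⟩ := I.bddAbove
    refine ⟨k + 1, fun y hy hy' => ?_⟩
    obtain ⟨j, hj, hyj⟩ := mem_iUnion₂.1 (hI ⟨hy, hy'⟩)
    exact ⟨j, Nat.lt_succ_of_le (hk hj), hyj⟩
  choose t ht using key
  exact ⟨fun c => t c.unpair.1 c.unpair.2, fun i n y hy hy' => by simpa using ht i n y hy hy'⟩

/-- If no prefix length certifies membership, counterexamples `s' n`, `p' n` agree with `s`, `p` up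
to `n`, so their points converge to `x`. A subsequence lifts to `v` with limit `y` in some `Z n`;
saturation of `s` puts `y` into some `cyl (s j)`, hence almost all `v k` too. This contradicts the
choice of counterexamples once their enumerations agree with `s` at `j`. -/
theorem exists_certifies_iff (hφ : IsCompactlyLifting φ Z) {δ : Representation X}
    (hδ : PContinuousOnDom δ.rep) {s p : Baire} {x : X} (hs : IsSaturated φ Z s)
    (hx : x ∈ δ.rep p) :
    (∃ n, Certifies δ φ Z n (pre s n) (pre p n)) ↔ x ∈ φ '' wordUnion s := by
  refine ⟨fun ⟨n, hn⟩ => hn s p x hs rfl rfl hx, fun hxs => ?_⟩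
  by_contra! hcon
  simp only [Certifies, not_forall] at hcon
  choose s' p' x' hs' hsp hpp hx' hnot using hcon
  have hx'x : Tendsto x' atTop (𝓝 x) := hδ.tendsto (tendsto_of_pre_eq hpp) hx' hx
  obtain ⟨n, y, hy, hyx, ψ, hψ, v, hv, hvy⟩ := hφ.lift x' x hx'x
  obtain ⟨z, hz, hzx⟩ := hxs
  obtain ⟨j, hj⟩ := mem_iUnion.1 (hs z hz n y hy (hyx.trans hzx.symm))
  have hev : ∀ᶠ k in atTop, v k ∈ cyl (s j) := hvy ((isOpen_cyl _).mem_nhds hj)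
  obtain ⟨k, hk1, hk2⟩ := (hev.and (eventually_gt_atTop j)).exists
  refine hnot (ψ k) ⟨v k, mem_iUnion.2 ⟨j, ?_⟩, hv k⟩
  -- Here `j < k ≤ ψ k`, so position `j` lies in the common prefix of `s' (ψ k)` and `s`.
  rwa [(pre_eq_iff _ _ _).1 (hsp (ψ k)) j (hk2.trans_le (hψ.id_le k))]

theorem rcontinuous_image_wordUnion (hφ : IsCompactlyLifting φ Z) {δ : Representation X}
    (hδ : PContinuousOnDom δ.rep) {s : Baire} (hs : IsSaturated φ Z s) :
    RContinuous δ sierpinski (fun x => x ∈ φ '' wordUnion s) := by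
  refine rcontinuous_of_isOpen δ _ {p | ∃ n, Certifies δ φ Z n (pre s n) (pre p n)} ?_
    fun p x hp => exists_certifies_iff hφ hδ hs hp
  refine isOpen_iff_mem_nhds.2 ?_
  rintro p ⟨n, hn⟩
  filter_upwards [pre_eventually_eq p n] with p' hp'
  exact ⟨n, hp' ▸ hn⟩

/-- The `n`-th output digit is released exactly at prefix length `n` and records whether that length
certifies membership. -/
theorem openName_mem (hφ : IsCompactlyLifting φ Z) {δ : Representation X}
    (hδ : PContinuousOnDom δ.rep) {s : Baire} (hs : IsSaturated φ Z s) :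
    (⟨fun x => x ∈ φ '' wordUnion s, rcontinuous_image_wordUnion hφ hδ hs⟩ : ROpen δ) ∈
      δ.opens.rep (openName δ φ Z s) := by
  classical
  have htake : ∀ (p : Baire) (n : ℕ), (pre p n).take n = pre p n := fun p n =>
    List.take_of_length_le (length_pre p n).le
  refine (mem_opens_iff _ _ _).2 fun p x hx => ?_
  refine ⟨fun n => if Certifies δ φ Z n (pre s n) (pre p n) then 1 else 0, fun n => ⟨n, ?_, ?_⟩, ?_⟩
  · simp only [openName, Encodable.encodek, Option.map_some, Option.getD_some, openNameAux,
      length_pre, lt_irrefl, if_false, htake]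
    split_ifs <;> rfl
  · intro j hj
    simp only [openName, Encodable.encodek, Option.map_some, Option.getD_some, openNameAux,
      length_pre, if_pos hj]
  · refine Iff.trans ?_ (exists_certifies_iff hφ hδ hs hx)
    simp

end Topology

theorem pre_take (p : Baire) {m n : ℕ} (h : m ≤ n) : (pre p n).take m = pre p m := by
  rw [pre, pre, ← List.map_take, List.take_range, min_eq_left h]

theorem pre_succ (p : Baire) (n : ℕ) : pre p (n + 1) = pre p n ++ [p n] := by
  simp [pre, List.range_succ]

/-! ### Trees of sections of closed sets -/

open Classical in
/-- The characteristic function of a tree whose paths are the points of the section over `q` of the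
closed set `E`. -/
noncomputable def sectionTree (E : Set (Baire × Baire)) (q : Baire) : Baire := fun c =>
  if ∃ x ∈ E, pre x.1 (Denumerable.ofNat (List ℕ) c).length =
      pre q (Denumerable.ofNat (List ℕ) c).length ∧
    pre x.2 (Denumerable.ofNat (List ℕ) c).length = Denumerable.ofNat (List ℕ) c then 1 else 0

theorem sectionTree_encode_eq_one {E : Set (Baire × Baire)} {q : Baire} {w : List ℕ} :
    sectionTree E q (Encodable.encode w) = 1 ↔
      ∃ x ∈ E, pre x.1 w.length = pre q w.length ∧ pre x.2 w.length = w := by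
  simp [sectionTree]

theorem continuous_sectionTree (E : Set (Baire × Baire)) : Continuous (sectionTree E) := by
  refine continuous_pi fun c => continuous_discrete_rng.2 fun k =>
    isOpen_iff_mem_nhds.2 fun q hq => ?_
  filter_upwards [pre_eventually_eq q (Denumerable.ofNat (List ℕ) c).length] with q' hq'
  have : sectionTree E q' c = sectionTree E q c := by rw [sectionTree, sectionTree, hq']
  exact this.trans hq

theorem codesTree_sectionTree (E : Set (Baire × Baire)) (q : Baire) :
    CodesTree (sectionTree E q) := by
  refine ⟨fun n => ?_, fun v w hvw => ?_⟩
  · unfold sectionTree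
    split_ifs
    · exact Or.inr rfl
    · exact Or.inl rfl
  · rw [sectionTree_encode_eq_one, sectionTree_encode_eq_one]
    rintro ⟨x, hx, h1, h2⟩
    refine ⟨x, hx, ?_, ?_⟩
    · rw [← pre_take x.1 hvw.length_le, h1, pre_take q hvw.length_le]
    · rw [← pre_take x.2 hvw.length_le, h2, ← List.prefix_iff_eq_take.1 hvw]

/-- A path `z` gives points of `E` that agree with `(q, z)` on ever longer prefixes; they converge
to it, and `E` is closed. -/
theorem codesWellFounded_sectionTree {E : Set (Baire × Baire)} (hE : IsClosed E) (q : Baire) :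
    CodesWellFounded (sectionTree E q) ↔ ¬ ∃ z, (q, z) ∈ E := by
  refine not_congr (exists_congr fun z => ?_)
  simp only [sectionTree_encode_eq_one, length_pre]
  refine ⟨fun h => ?_, fun h n => ⟨(q, z), h, rfl, rfl⟩⟩
  choose x hx h1 h2 using h
  have hlim : Tendsto x atTop (𝓝 (q, z)) :=
    (tendsto_of_pre_eq (v := fun n => (x n).1) h1).prodMk_nhds
      (tendsto_of_pre_eq (v := fun n => (x n).2) h2)
  exact hE.mem_of_tendsto hlim (Eventually.of_forall hx)

/-! ### Disjointness from an overt set as a section -/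

/-- The sequence computed by the associate `q` on `u` has no non-zero digit. -/
def EvaluatesToZero (q u : Baire) : Prop :=
  ∀ n m, ¬ (2 ≤ q (Encodable.encode (n :: pre u m)) ∧
    ∀ j < m, q (Encodable.encode (n :: pre u j)) = 0)

/-- An associate value `k + 1` encodes the digit `k`, so a first non-zero value of at least 2 is a
non-zero digit. The condition ignores whether the computation converges, which makes it closed in
`q` and `u`. -/
theorem AssociateGraph.evaluatesToZero_iff {q u r : Baire} (h : AssociateGraph q u r) :
    EvaluatesToZero q u ↔ ¬ ∃ n, r n ≠ 0 := by
  unfold EvaluatesToZero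
  rw [← not_exists_not]
  simp only [not_forall, not_not]
  refine not_congr (exists_congr fun n => ?_)
  obtain ⟨m, h1, h2⟩ := h n
  constructor
  · rintro ⟨m', h1', h2'⟩
    have hm : m = m' := by
      rcases lt_trichotomy m m' with hlt | heq | hgt
      · have := h2' m hlt
        omega
      · exact heq
      · have := h2 m' hgt
        omega
    subst hm
    omega
  · exact fun hr => ⟨m, by omega, h2⟩

theorem isClosed_evaluatesToZero : IsClosed {x : Baire × Baire | EvaluatesToZero x.1 x.2} := by
  have hc : ∀ n m, Continuous fun x : Baire × Baire => x.1 (Encodable.encode (n :: pre x.2 m)) := by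
    intro n m
    refine continuous_discrete_rng.2 fun k => isOpen_iff_mem_nhds.2 fun x hx => ?_
    have h1 : ∀ᶠ y : Baire × Baire in 𝓝 x, pre y.2 m = pre x.2 m :=
      continuous_snd.continuousAt.eventually (pre_eventually_eq x.2 m)
    have h2 : ∀ᶠ y : Baire × Baire in 𝓝 x, y.1 (Encodable.encode (n :: pre x.2 m)) = k :=
      continuous_fst.continuousAt.eventually ((isOpen_coord _ k).mem_nhds hx)
    filter_upwards [h1, h2] with y hy1 hy2
    rw [mem_preimage, hy1]
    exact hy2
  simp only [EvaluatesToZero, ofPred_forall]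
  refine isClosed_iInter fun n => isClosed_iInter fun m => isOpen_compl_iff.1 ?_
  have : {x : Baire × Baire | ¬ (2 ≤ x.1 (Encodable.encode (n :: pre x.2 m)) ∧
      ∀ j < m, x.1 (Encodable.encode (n :: pre x.2 j)) = 0)}ᶜ =
      (fun x : Baire × Baire => x.1 (Encodable.encode (n :: pre x.2 m))) ⁻¹' Ici 2 ∩
        ⋂ j ∈ Finset.range m,
          (fun x : Baire × Baire => x.1 (Encodable.encode (n :: pre x.2 j))) ⁻¹' {0} := by
    ext x
    simp
  rw [this]
  exact ((isOpen_discrete _).preimage (hc n m)).inter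
    (isOpen_biInter_finset fun j _ => (isOpen_discrete _).preimage (hc n j))

/-- A violation at `(i, n)` involves only the bound `t (Nat.pair i n)`, the word `s i` and the words
`s j` below the bound, so it persists in a neighbourhood. -/
theorem isClosed_saturationWitness (φ : Baire → X) (Z : ℕ → Set Baire) :
    IsClosed {x : Baire × Baire | SaturationWitness φ Z x.1 x.2} := by
  simp only [SaturationWitness, ofPred_forall (ι := ℕ)]
  refine isClosed_iInter fun i => isClosed_iInter fun n => isOpen_compl_iff.1 ?_
  refine isOpen_iff_mem_nhds.2 fun x hx => ?_
  have h1 : ∀ᶠ y : Baire × Baire in 𝓝 x, y.2 (Nat.pair i n) = x.2 (Nat.pair i n) :=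
    continuous_snd.continuousAt.eventually ((isOpen_coord _ _).mem_nhds rfl)
  have h2 : ∀ᶠ y : Baire × Baire in 𝓝 x, y.1 i = x.1 i :=
    continuous_fst.continuousAt.eventually ((isOpen_coord _ _).mem_nhds rfl)
  have h3 : ∀ᶠ y : Baire × Baire in 𝓝 x, pre y.1 (x.2 (Nat.pair i n)) = pre x.1 (x.2 (Nat.pair i n)) :=
    continuous_fst.continuousAt.eventually (pre_eventually_eq _ _)
  filter_upwards [h1, h2, h3] with y hy1 hy2 hy3
  rw [pre_eq_iff] at hy3
  refine fun hy => hx fun p hp hpφ => ?_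
  obtain ⟨j, hj, hpj⟩ := hy p hp (hy2.symm ▸ hpφ)
  rw [hy1] at hj
  exact ⟨j, hj, hy3 j hj ▸ hpj⟩

/-- The pairs of `q` and a witness, according to `q`, that an open set that contains `φ '' cyl c` is
disjoint from the overt set named by `q`. -/
def disjointnessWitnesses (δ : Representation X) (φ : Baire → X) (Z : ℕ → Set Baire) (c : ℕ) :
    Set (Baire × Baire) :=
  {x | proj x.2 0 0 = c ∧ SaturationWitness φ Z (proj x.2 0) (proj x.2 1) ∧
    EvaluatesToZero x.1 (openName δ φ Z (proj x.2 0))}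

theorem continuous_proj (n : ℕ) : Continuous fun p : Baire => proj p n :=
  continuous_pi fun k => continuous_apply (Nat.pair n k)

theorem isClosed_disjointnessWitnesses (δ : Representation X) (φ : Baire → X) (Z : ℕ → Set Baire)
    (c : ℕ) : IsClosed (disjointnessWitnesses δ φ Z c) := by
  have h0 : Continuous fun x : Baire × Baire => proj x.2 0 := (continuous_proj 0).comp continuous_snd
  have h1 : Continuous fun x : Baire × Baire => proj x.2 1 := (continuous_proj 1).comp continuous_snd
  refine IsClosed.inter ?_ (IsClosed.inter ?_ ?_)
  · have hc : Continuous fun x : Baire × Baire => proj x.2 0 0 := (continuous_apply 0).comp h0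
    exact (isClosed_discrete ({c} : Set ℕ)).preimage hc
  · exact (isClosed_saturationWitness φ Z).preimage (h0.prodMk h1)
  · exact isClosed_evaluatesToZero.preimage
      (continuous_fst.prodMk ((continuous_openName δ φ Z).comp h0))

theorem exists_proj_eq (s t : Baire) : ∃ z, proj z 0 = s ∧ proj z 1 = t := by
  refine ⟨fun c => if c.unpair.1 = 0 then s c.unpair.2 else t c.unpair.2, ?_, ?_⟩ <;>
  · funext k
    simp [proj]

theorem mem_overt_iff (δ : Representation X) (q : Baire) (A : RClosed δ) :
    A ∈ δ.overt.rep q ↔ meets δ A.1 ∈ δ.opens.opens.rep q :=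
  mem_pfunOfGraph (R := fun (q : Baire) (A : RClosed δ) => meets δ A.1 ∈ δ.opens.opens.rep q)
    (fun _ _ _ h h' => meets_injective δ _ _ (Part.mem_unique h h')) q A

theorem mem_seq_iff (δ : Representation X) (p : Baire) (x : ℕ → X) :
    x ∈ δ.seq.rep p ↔ ∀ n, x n ∈ δ.rep (proj p n) :=
  mem_pfunOfGraph (R := fun (p : Baire) (x : ℕ → X) => ∀ n, x n ∈ δ.rep (proj p n))
    (fun _ _ _ h h' => funext fun n => Part.mem_unique (h n) (h' n)) p x

section Topology

variable [TopologicalSpace X] {φ : Baire → X} {Z : ℕ → Set Baire} {δ : Representation X}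

theorem evaluatesToZero_openName_iff (hφ : IsCompactlyLifting φ Z) (hδ : PContinuousOnDom δ.rep)
    {A : RClosed δ} {q s : Baire} (hq : A ∈ δ.overt.rep q) (hs : IsSaturated φ Z s) :
    EvaluatesToZero q (openName δ φ Z s) ↔ φ '' wordUnion s ∩ A.1 = ∅ := by
  obtain ⟨r, hr, hrA⟩ := (mem_opens_iff _ _ _).1 ((mem_overt_iff δ q A).1 hq) _ _ (openName_mem hφ hδ hs)
  rw [hr.evaluatesToZero_iff, hrA, ← not_nonempty_iff_eq_empty]
  refine not_congr ⟨?_, ?_⟩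
  · rintro ⟨x, hxA, hx⟩
    exact ⟨x, hx, hxA⟩
  · rintro ⟨x, hx, hxA⟩
    exact ⟨x, hxA, hx⟩

/-- Any witness encloses `φ '' cyl c` in a set that misses `A`. Conversely, the preimage of the
complement of `A` is open and saturated, being a full preimage, and an enumeration of it starting
with `c` yields a witness. -/
theorem exists_disjointnessWitness_iff (hφ : IsCompactlyLifting φ Z) (hδ : PContinuousOnDom δ.rep)
    {A : RClosed δ} (hA : IsOpen {p | φ p ∉ A.1}) {q : Baire} (hq : A ∈ δ.overt.rep q) (c : ℕ) :
    (∃ z, (q, z) ∈ disjointnessWitnesses δ φ Z c) ↔ ∀ p ∈ cyl c, φ p ∉ A.1 := by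
  constructor
  · rintro ⟨z, h0, hw, he⟩ p hp hpA
    have hempty := (evaluatesToZero_openName_iff hφ hδ hq hw.isSaturated).1 he
    have hmem : φ p ∈ φ '' wordUnion (proj z 0) ∩ A.1 :=
      ⟨⟨p, mem_iUnion.2 ⟨0, h0.symm ▸ hp⟩, rfl⟩, hpA⟩
    rw [hempty] at hmem
    exact hmem
  · intro h
    obtain ⟨s, hs0, hsU⟩ := exists_wordUnion_eq hA h
    have hsat : IsSaturated φ Z s := by
      intro y hy n y' _ he
      rw [hsU] at hy ⊢
      rwa [mem_ofPred_eq, he]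
    obtain ⟨t, ht⟩ := hsat.exists_witness hφ
    obtain ⟨z, rfl, rfl⟩ := exists_proj_eq s t
    refine ⟨z, hs0, ht, (evaluatesToZero_openName_iff hφ hδ hq hsat).2 ?_⟩
    rw [hsU]
    ext x
    simp only [mem_inter_iff, mem_image, mem_empty_iff_false, iff_false]
    rintro ⟨⟨p, hp, rfl⟩, hpA⟩
    exact hp hpA

end Topology

/-! ### Search -/

open Classical in
/-- The first digit found that extends the word `w` to a word with a positive answer in `r`. -/
noncomputable def searchStep (r : Baire) (w : List ℕ) : ℕ :=
  if h : ∃ c : ℕ, proj r (Encodable.encode (w ++ [c.unpair.1])) c.unpair.2 ≠ 0 then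
    (Nat.find h).unpair.1 else 0

/-- The words found by repeated search. -/
noncomputable def searchWord (r : Baire) : ℕ → List ℕ
  | 0 => []
  | n + 1 => searchWord r n ++ [searchStep r (searchWord r n)]

/-- The sequence found by repeated search. -/
noncomputable def search (r : Baire) : Baire := fun n => searchStep r (searchWord r n)

/-- Each step of the search is successful. -/
def SearchSucceeds (r : Baire) : Prop :=
  ∀ n, ∃ c : ℕ, proj r (Encodable.encode (searchWord r n ++ [c.unpair.1])) c.unpair.2 ≠ 0

theorem pre_search (r : Baire) (n : ℕ) : pre (search r) n = searchWord r n := by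
  induction n with
  | zero => rfl
  | succ n ih => rw [pre_succ, ih, search, searchWord]

theorem searchStep_spec {r : Baire} {w : List ℕ}
    (h : ∃ c : ℕ, proj r (Encodable.encode (w ++ [c.unpair.1])) c.unpair.2 ≠ 0) :
    ∃ n, proj r (Encodable.encode (w ++ [searchStep r w])) n ≠ 0 := by
  classical
  refine ⟨(Nat.find h).unpair.2, ?_⟩
  rw [searchStep, dif_pos h]
  exact Nat.find_spec h

/-- A successful search stops after inspecting finitely many answers. -/
theorem searchStep_eventually_eq {r : Baire} {w : List ℕ}
    (h : ∃ c : ℕ, proj r (Encodable.encode (w ++ [c.unpair.1])) c.unpair.2 ≠ 0) :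
    ∀ᶠ r' in 𝓝 r, searchStep r' w = searchStep r w := by
  classical
  have hev : ∀ᶠ r' in 𝓝 r, ∀ c ∈ Finset.range (Nat.find h + 1),
      proj r' (Encodable.encode (w ++ [c.unpair.1])) c.unpair.2 =
        proj r (Encodable.encode (w ++ [c.unpair.1])) c.unpair.2 :=
    (Filter.eventually_all_finset _).2 fun c _ => (isOpen_coord _ _).mem_nhds rfl
  filter_upwards [hev] with r' hr'
  have hspec := hr' (Nat.find h) (Finset.self_mem_range_succ _)
  have h' : ∃ c : ℕ, proj r' (Encodable.encode (w ++ [c.unpair.1])) c.unpair.2 ≠ 0 :=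
    ⟨Nat.find h, hspec ▸ Nat.find_spec h⟩
  rw [searchStep, searchStep, dif_pos h, dif_pos h']
  congr 2
  refine (Nat.find_eq_iff h').2 ⟨hspec ▸ Nat.find_spec h, fun c hc => ?_⟩
  rw [hr' c (Finset.mem_range.2 (hc.trans (Nat.lt_succ_self _)))]
  exact Nat.find_min h hc

theorem SearchSucceeds.continuousAt {r : Baire} (h : SearchSucceeds r) :
    ContinuousAt search r := by
  have hw : ∀ n, ∀ᶠ r' in 𝓝 r, searchWord r' n = searchWord r n := by
    intro n
    induction n with
    | zero => exact Eventually.of_forall fun _ => rfl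
    | succ n ih =>
      filter_upwards [ih, searchStep_eventually_eq (h n)] with r' h1 h2
      rw [searchWord, searchWord, h1, h2]
  refine continuousAt_pi.2 fun n => ContinuousAt.congr continuousAt_const
    (f := fun _ => search r n) ?_
  filter_upwards [hw n, searchStep_eventually_eq (h n)] with r' h1 h2
  rw [search, search, h1, h2]

theorem SearchSucceeds.answer {r : Baire} (h : SearchSucceeds r) (m : ℕ) :
    ∃ n, proj r (Encodable.encode (pre (search r) (m + 1))) n ≠ 0 := by
  rw [pre_search, searchWord]
  exact searchStep_spec (h m)

/-- If the answers in `r` say which cylinders meet a non-empty set, the search succeeds. -/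
theorem searchSucceeds_of_answers {r : Baire} {S : Set Baire} (hS : S.Nonempty)
    (hr : ∀ c, (∃ n, proj r c n ≠ 0) ↔ (cyl c ∩ S).Nonempty) : SearchSucceeds r := by
  have key : ∀ n, (∃ p ∈ S, pre p n = searchWord r n) → ∃ c : ℕ,
      proj r (Encodable.encode (searchWord r n ++ [c.unpair.1])) c.unpair.2 ≠ 0 := by
    rintro n ⟨p, hp, hpn⟩
    obtain ⟨k, hk⟩ := (hr (Encodable.encode (pre p (n + 1)))).2 ⟨p, mem_cyl_pre p n, hp⟩
    -- The search index pairs a candidate digit with the stage at which its positive answer appears.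
    refine ⟨Nat.pair (p n) k, ?_⟩
    rw [Nat.unpair_pair, ← hpn, ← pre_succ]
    exact hk
  -- The invariant is that every word found is a prefix of a point of `S`; such a point supplies the
  -- next digit.
  have hex : ∀ n, ∃ p ∈ S, pre p n = searchWord r n := by
    intro n
    induction n with
    | zero =>
      obtain ⟨p, hp⟩ := hS
      exact ⟨p, hp, rfl⟩
    | succ n ih =>
      obtain ⟨p, hp, hpS⟩ := (hr _).1 (searchStep_spec (key n ih))
      refine ⟨p, hpS, ?_⟩
      have hp' : p ∈ cyl (Encodable.encode (searchWord r (n + 1))) := hp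
      rw [← pre_search] at hp' ⊢
      exact mem_cyl_encode_pre.1 hp'
  exact fun n => key n (hex n)

/-- Every prefix of the result extends to a point of `S`, so the result is a limit of points of `S`.
-/
theorem search_mem {r : Baire} {S : Set Baire} (hS : IsClosed S) (h : SearchSucceeds r)
    (hr : ∀ c, (∃ n, proj r c n ≠ 0) ↔ (cyl c ∩ S).Nonempty) : search r ∈ S := by
  have hex : ∀ m, ∃ p ∈ S, pre p (m + 1) = pre (search r) (m + 1) := by
    intro m
    obtain ⟨p, hp, hpS⟩ := (hr _).1 (h.answer m)
    exact ⟨p, hpS, mem_cyl_encode_pre.1 hp⟩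
  choose v hv hvp using hex
  refine hS.mem_of_tendsto (tendsto_of_pre_eq (v := v) fun n => ?_) (Eventually.of_forall hv)
  rw [← pre_take _ n.le_succ, hvp, pre_take _ n.le_succ]

/-- The second component of a pair. -/
def unpairRight (p : Baire) : Baire := fun n => p (2 * n + 1)

theorem unpairRight_pair (p q : Baire) : unpairRight (pair p q) = q := by
  funext n
  have h1 : (2 * n + 1) % 2 = 1 := by omega
  have h2 : (2 * n + 1) / 2 = n := by omega
  simp [unpairRight, pair, h1, h2]

theorem continuous_unpairRight : Continuous unpairRight :=
  continuous_pi fun n => continuous_apply (2 * n + 1)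

/-- The trees that ask, for each `c`, whether the overt set named by `q` meets `φ '' cyl c`. -/
noncomputable def questions {X : Type*} (δ : Representation X) (φ : Baire → X) (Z : ℕ → Set Baire)
    (q : Baire) : Baire :=
  fun k => sectionTree (disjointnessWitnesses δ φ Z k.unpair.1) q k.unpair.2

theorem continuous_questions {X : Type*} (δ : Representation X) (φ : Baire → X)
    (Z : ℕ → Set Baire) : Continuous (questions δ φ Z) :=
  continuous_pi fun k => (continuous_apply k.unpair.2).comp (continuous_sectionTree _)

theorem proj_questions {X : Type*} (δ : Representation X) (φ : Baire → X) (Z : ℕ → Set Baire)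
    (q : Baire) (c : ℕ) :
    proj (questions δ φ Z q) c = sectionTree (disjointnessWitnesses δ φ Z c) q := by
  funext k
  simp [proj, questions]

/-- The output of the reduction: the image under `g` of the sequence found by search. -/
noncomputable def searchOutput (g : Baire → Baire) : Baire →. Baire :=
  fun x => ⟨SearchSucceeds (unpairRight x), fun _ => g (search (unpairRight x))⟩

theorem pContinuousOnDom_searchOutput {g : Baire → Baire} (hg : Continuous g) :
    PContinuousOnDom (searchOutput g) := by
  refine continuous_iff_continuousAt.2 fun ⟨x, hx⟩ => ?_
  have hs : SearchSucceeds (unpairRight x) := hx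
  have h1 : ContinuousAt (fun y : (searchOutput g).Dom => unpairRight y) ⟨x, hx⟩ :=
    (continuous_unpairRight.comp continuous_subtype_val).continuousAt
  have h2 : ContinuousAt (fun y : (searchOutput g).Dom => search (unpairRight y)) ⟨x, hx⟩ :=
    ContinuousAt.comp (g := search) hs.continuousAt h1
  exact ContinuousAt.comp (g := g) hg.continuousAt h2

/-- A name of a sequence of truth values is turned by a realizer of the parallelized identity into a
sequence of semi-decisions. -/
theorem exists_answers {G : Baire →. Baire}
    (hG : Realizes sigmaPi11.seq sierpinski.seq G (parallelization idSigma)) {p : Baire}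
    (hp : ∀ c, CodesTree (proj p c)) :
    ∃ r ∈ G p, ∀ c, (∃ n, proj r c n ≠ 0) ↔ CodesWellFounded (proj p c) := by
  have hx : (fun c => CodesWellFounded (proj p c)) ∈ sigmaPi11.seq.rep p :=
    (mem_seq_iff _ _ _).2 fun c => ⟨hp c, rfl⟩
  obtain ⟨r, hr, y, hy, hyx⟩ := hG p _ hx ⟨_, fun c => rfl⟩
  refine ⟨r, hr, fun c => ?_⟩
  have h1 : y c = ∃ n, proj r c n ≠ 0 := Part.mem_some_iff.1 ((mem_seq_iff _ _ _).1 hy c)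
  have h2 : y c = CodesWellFounded (proj p c) := hyx c
  rw [← h1, h2]

end OvertChoice

open OvertChoice in
theorem mainTheorem11 {X : Type*} [TopologicalSpace X] (hX : OvertChoice.IsCoPolish X)
    (δ : OvertChoice.Representation X) (hδ : OvertChoice.IsAdmissible δ) :
    OvertChoice.WeihrauchLE δ.overt δ (OvertChoice.VC δ)
      OvertChoice.sigmaPi11.seq OvertChoice.sierpinski.seq
      (OvertChoice.parallelization OvertChoice.idSigma) := by
  -- Over an empty space no set has a point to choose, so any maps work.
  rcases isEmpty_or_nonempty X with hempty | hne
  · exact ⟨fun p => Part.some p, fun p => Part.some p, PContinuousOnDom.of_total continuous_id,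
      PContinuousOnDom.of_total continuous_id, fun _ _ _ _ _ ⟨x, _⟩ => hempty.elim x⟩
  obtain ⟨φ, Z, hφ⟩ := exists_isCompactlyLifting hX
  obtain ⟨hδc, hδa⟩ := hδ
  -- Admissibility, applied to the total map `φ`, yields the continuous lift `g` to names.
  obtain ⟨F, hF, hFφ⟩ := hδa _ (PContinuousOnDom.of_total hφ.continuous)
  obtain ⟨g, hg, hgF⟩ := hF.exists_total continuous_id fun p =>
    Part.dom_iff_mem.2 ((hFφ p _ (Part.mem_some _)).imp fun _ h => h.1)
  have hgφ : ∀ p, φ p ∈ δ.rep (g p) := by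
    intro p
    obtain ⟨q, hq, hqφ⟩ := hFφ p _ (Part.mem_some _)
    exact Part.mem_unique hq (hgF p) ▸ hqφ
  refine ⟨fun q => Part.some (questions δ φ Z q), searchOutput g,
    PContinuousOnDom.of_total (continuous_questions δ φ Z), pContinuousOnDom_searchOutput hg,
    fun G hG q A hq hA => ?_⟩
  have hopen : IsOpen {p | φ p ∉ A.1} := isOpen_preimage_of_rcontinuous hg hgφ A.2
  obtain ⟨r, hr, hrA⟩ := exists_answers hG (p := questions δ φ Z q) fun c => by
    rw [proj_questions]
    exact codesTree_sectionTree _ _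
  have hans : ∀ c, (∃ n, proj r c n ≠ 0) ↔ (cyl c ∩ {p | φ p ∈ A.1}).Nonempty := by
    intro c
    rw [hrA, proj_questions, codesWellFounded_sectionTree (isClosed_disjointnessWitnesses δ φ Z c),
      exists_disjointnessWitness_iff hφ hδc hopen hq]
    simp only [not_forall, not_not, exists_prop]
    rfl
  have hne : {p | φ p ∈ A.1}.Nonempty := by
    obtain ⟨x, hx⟩ := hA
    -- Lifting a constant sequence shows that `φ` is surjective.
    obtain ⟨-, y, -, hy, -⟩ := hφ.lift (fun _ => x) x tendsto_const_nhds
    refine ⟨y, ?_⟩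
    change φ y ∈ A.1
    rw [hy]
    exact hx
  have hsucc := searchSucceeds_of_answers hne hans
  have hmem := search_mem (isOpen_compl_iff.1 hopen) hsucc hans
  refine ⟨g (search r), ?_, φ (search r), hgφ _, hmem⟩
  simp only [Part.bind_some, Part.mem_bind_iff]
  refine ⟨r, hr, ?_⟩
  have hdom : (searchOutput g (pair q r)).Dom := by
    rw [← unpairRight_pair q r] at hsucc
    exact hsucc
  refine ⟨hdom, ?_⟩
  change g (search (unpairRight (pair q r))) = g (search r)
  rw [unpairRight_pair]
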